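/- All graphs are finite. A \emph{marked permutation graph} is a pair $(G,M)$, where $G$ is a cubic graph and $M$ is a perfect matching of $G$ such that $G-E(M)$ is the disjoint union of two cycles, neither of which has a chord in $G$. A graph is \emph{cyclically $5$-edge-connected} if it contains no edge-cut of size at most $4$ whose removal leaves at least two components that are not trees. An \emph{$M$-copy of the Petersen graph} $P_{10}$ is a subgraph of $G$ that is isomorphic to a subdivision of $P_{10}$ and is composed of the two cycles of $G-E(M)$ together with five edges of $M$. \textbf{Corollary.} Let $(G,M)$ be a marked permutation graph such that $G$ is cyclically $5$-edge-connected. Then every edge of $G$ (in particular, every edge of $M$) is contained in an $M$-copy of the Petersen graph. -/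

import Mathlib

/-- The Petersen graph: an outer 5-cycle on the vertices `inl i`, an inner pentagram on the vertices
`inr i`, and a spoke joining `inl i` to `inr i` for each `i`. -/
def petersenGraph : SimpleGraph (Fin 5 ⊕ Fin 5) where
  Adj
    | .inl i, .inl j => j = i + 1 ∨ i = j + 1
    | .inr i, .inr j => j = i + 2 ∨ i = j + 2
    | .inl i, .inr j => i = j
    | .inr i, .inl j => i = j
  symm := ⟨by
    rintro (i | i) (j | j) h
    · exact h.symm
    · exact Eq.symm h
    · exact Eq.symm h
    · exact h.symm⟩
  loopless := ⟨by
    rintro (i | i) h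
    · revert i; decide
    · revert i; decide⟩

/-- `K` is isomorphic to a subdivision of the simple graph `P`: the vertices of `P` are sent
injectively to branch vertices of `K`, and each edge of `P` to a path of `K` joining the branch
vertices of its ends, such that the paths are internally disjoint, have no branch vertex in their
interior, and together with the branch vertices make up all of `K`. -/
def IsSubdivisionOf {α β : Type*} (K : SimpleGraph β) (P : SimpleGraph α) : Prop :=
  ∃ (f : α → β) (path : ∀ a b : α, P.Adj a b → K.Walk (f a) (f b)),
    Function.Injective f ∧
    (∀ a b (h : P.Adj a b), (path a b h).IsPath) ∧
    (∀ a b (h : P.Adj a b), path b a h.symm = (path a b h).reverse) ∧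
    (∀ a b (h : P.Adj a b) (c : α), f c ∈ (path a b h).support → c = a ∨ c = b) ∧
    (∀ a b (h : P.Adj a b) c d (h' : P.Adj c d), s(a, b) ≠ s(c, d) →
      ∀ x, x ∈ (path a b h).support → x ∈ (path c d h').support → x ∈ Set.range f) ∧
    (∀ x : β, x ∈ Set.range f ∨ ∃ a b, ∃ h : P.Adj a b, x ∈ (path a b h).support) ∧
    (∀ e ∈ K.edgeSet, ∃ a b, ∃ h : P.Adj a b, e ∈ (path a b h).edges)

/-- The subgraph `C` of `G` is a cycle. -/
def IsCycleSubgraph {V : Type*} {G : SimpleGraph V} (C : G.Subgraph) : Prop :=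
  ∃ (v : V) (p : G.Walk v v), p.IsCycle ∧ C = p.toSubgraph

/-- `(G, M)` is a marked permutation graph: `G` is cubic and `M` is a perfect matching of `G` such
that `G - E(M)` is the disjoint union of two cycles, none of which has a chord in `G`
(a cycle is chordless when it is an induced subgraph). -/
def IsMarkedPermutationGraph {V : Type*} [Fintype V] (G : SimpleGraph V) [DecidableRel G.Adj]
    (M : G.Subgraph) : Prop :=
  G.IsRegularOfDegree 3 ∧ M.IsPerfectMatching ∧
    ∃ C₁ C₂ : G.Subgraph, IsCycleSubgraph C₁ ∧ IsCycleSubgraph C₂ ∧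
      Disjoint C₁.verts C₂.verts ∧
      (⊤ : G.Subgraph).deleteEdges M.edgeSet = C₁ ⊔ C₂ ∧
      C₁.IsInduced ∧ C₂.IsInduced

/-- `F` is an edge-cut of `G`: the set of all edges of `G` between `S` and its complement, for some
set `S` of vertices with `S` and its complement nonempty. -/
def IsEdgeCut {V : Type*} (G : SimpleGraph V) (F : Set (Sym2 V)) : Prop :=
  ∃ S : Set V, S.Nonempty ∧ Sᶜ.Nonempty ∧
    F = {e | e ∈ G.edgeSet ∧ ∃ u ∈ S, ∃ v ∈ Sᶜ, e = s(u, v)}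

/-- `G` is cyclically `k`-edge-connected: it has no edge-cut of size less than `k` whose removal
leaves at least two components that are not trees. -/
def IsCyclicallyEdgeConnected {V : Type*} (G : SimpleGraph V) (k : ℕ) : Prop :=
  ¬ ∃ F : Set (Sym2 V), IsEdgeCut G F ∧ F.encard < k ∧
    ∃ c₁ c₂ : (G.deleteEdges F).ConnectedComponent, c₁ ≠ c₂ ∧
      ¬ c₁.toSimpleGraph.IsTree ∧ ¬ c₂.toSimpleGraph.IsTree

/-- `H` is an `M`-copy of the Petersen graph in `G`: a subgraph of `G` isomorphic to a subdivision of
the Petersen graph and composed of `G - E(M)` together with five edges of `M`. -/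
def IsPetersenCopy {V : Type*} {G : SimpleGraph V} (M H : G.Subgraph) : Prop :=
  IsSubdivisionOf H.coe petersenGraph ∧
    ∃ S : Finset (Sym2 V), (S : Set (Sym2 V)) ⊆ M.edgeSet ∧ S.card = 5 ∧
      H.verts = Set.univ ∧ H.edgeSet = (G.edgeSet \ M.edgeSet) ∪ S

/-! Since both cycles are induced, every edge of `M` joins one cycle to the other. Fix an edge of
`M` and number both cycles from its ends, so that it becomes `x 0`–`y 0`. The remaining edges of `M`
are then the graph of an injection `f` on the positive indices, a permutation written in linear
order.

If `f` contains the pattern 3142 or 2413, the four edges of the pattern and the base edge meet the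
second cycle in the pentagram order relative to the first. Together with the two cycles they form a
subdivision of the Petersen graph (`isSubdivisionOf_petersenGraph`).

If `f` avoids both patterns, then it is a direct or a skew sum
(`hasSimplePattern_or_isDirectSplit`). An interval of the first cycle is then matched exactly onto
an interval of the second. At most four edges leave the union of the two intervals, namely the
boundary edges on the cycles. Two matching edges on each side close up a cycle there, which
contradicts cyclic 5-edge-connectivity. The same hypothesis, applied to the cut `M` between the
cycles, gives `5 ≤ n`, so there is enough room for this.

An edge outside `M` lies in every `M`-copy, so the existence of one copy suffices for it. -/

/-! ### Permutations avoiding 3142 and 2413 -/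

/-- `f` restricted to `s` contains one of the patterns `3142` and `2413`. -/
def HasSimplePattern {α β : Type*} [LinearOrder α] [LinearOrder β] (f : α → β) (s : Finset α) :
    Prop :=
  ∃ a ∈ s, ∃ b ∈ s, ∃ c ∈ s, ∃ d ∈ s, a < b ∧ b < c ∧ c < d ∧
    (f b < f d ∧ f d < f a ∧ f a < f c ∨ f c < f a ∧ f a < f d ∧ f d < f b)

/-- `A` is a nonempty proper initial segment of `s` that `f` maps below the rest of `s`. -/
def IsDirectSplit {α β : Type*} [LinearOrder α] [LinearOrder β] (f : α → β) (s A : Finset α) :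
    Prop :=
  A ⊆ s ∧ A.Nonempty ∧ A ≠ s ∧ (∀ a ∈ A, ∀ b ∈ s, b ∉ A → a < b) ∧
    ∀ a ∈ A, ∀ b ∈ s, b ∉ A → f a < f b

theorem HasSimplePattern.of_toDual {α β : Type*} [LinearOrder α] [LinearOrder β] {f : α → β}
    {s : Finset α} (h : HasSimplePattern (fun a => OrderDual.toDual (f a)) s) :
    HasSimplePattern f s := by
  obtain ⟨a, ha, b, hb, c, hc, d, hd, hab, hbc, hcd, h⟩ := h
  refine ⟨a, ha, b, hb, c, hc, d, hd, hab, hbc, hcd, ?_⟩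
  simp only [OrderDual.toDual_lt_toDual] at h
  tauto

theorem HasSimplePattern.mono {α β : Type*} [LinearOrder α] [LinearOrder β] {f : α → β}
    {s t : Finset α} (hst : s ⊆ t) (h : HasSimplePattern f s) : HasSimplePattern f t := by
  obtain ⟨a, ha, b, hb, c, hc, d, hd, h⟩ := h
  exact ⟨a, hst ha, b, hst hb, c, hst hc, d, hst hd, h⟩

/-- Take the smallest initial block `A` and compare the value at the new last point `x` with the
values on `A`. If it lies above them, `A` still splits off; if it lies below them, `x` itself splits
off as a skew summand; if it lies among them, minimality of `A` produces 3142. -/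
theorem isDirectSplit_insert {α β : Type*} [LinearOrder α] [LinearOrder β] (f : α → β)
    (s : Finset α) (x : α) (hx : ∀ y ∈ s, y < x) (hfx : ∀ y ∈ s, f y ≠ f x)
    (h : ∃ A, IsDirectSplit f s A) :
    HasSimplePattern f (insert x s) ∨ (∃ A, IsDirectSplit f (insert x s) A) ∨
      ∃ A, IsDirectSplit (fun a => OrderDual.toDual (f a)) (insert x s) A := by
  have hxs : x ∉ s := fun h => (hx x h).false
  obtain ⟨A, ⟨hAs, hne, hneq, h1, h2⟩, hmin⟩ := exists_minimal_of_wellFoundedLT _ h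
  by_cases hhi : ∀ a ∈ A, f a < f x
  · refine Or.inr (Or.inl ⟨A, hAs.trans (Finset.subset_insert _ _), hne, ?_, ?_, ?_⟩)
    · rintro rfl
      exact hxs (hAs (Finset.mem_insert_self _ _))
    · intro a ha b hb hbA
      rcases Finset.mem_insert.1 hb with rfl | hb
      exacts [hx a (hAs ha), h1 a ha b hb hbA]
    · intro a ha b hb hbA
      rcases Finset.mem_insert.1 hb with rfl | hb
      exacts [hhi a ha, h2 a ha b hb hbA]
  by_cases hlo : ∀ a ∈ A, f x < f a
  · obtain ⟨a₀, ha₀⟩ := hne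
    -- The values on `A` lie below those on the rest of `s`, so `f x` is below all of `f` on `s`.
    refine Or.inr (Or.inr ⟨s, Finset.subset_insert _ _, ⟨a₀, hAs ha₀⟩, ?_, ?_, ?_⟩)
    · intro h
      exact hxs (h ▸ Finset.mem_insert_self _ _)
    · intro a ha b hb hbs
      obtain rfl : b = x := (Finset.mem_insert.1 hb).resolve_right hbs
      exact hx a ha
    · intro a ha b hb hbs
      obtain rfl : b = x := (Finset.mem_insert.1 hb).resolve_right hbs
      rw [OrderDual.toDual_lt_toDual]
      by_cases haA : a ∈ A
      exacts [hlo a haA, (hlo a₀ ha₀).trans (h2 a₀ ha₀ a ha haA)]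
  left
  push Not at hhi hlo
  obtain ⟨p, hpA, hp⟩ := hhi
  obtain ⟨q, hqA, hq⟩ := hlo
  obtain ⟨c, hcs, hcA⟩ : ∃ c ∈ s, c ∉ A := by
    by_contra! hcon
    exact hneq (hAs.antisymm hcon)
  -- Without such an inversion across the level `f x`, the points of `A` with value below `f x`
  -- would form a smaller block that splits off. With `c` outside `A`, the points `a < b < c < x`
  -- then have pattern 3142.
  obtain ⟨b, hbA, hb, a, haA, ha, hab⟩ :
      ∃ b ∈ A, f b < f x ∧ ∃ a ∈ A, f x < f a ∧ a < b := by
    by_contra! hcon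
    have hsub : A.filter (fun l => f l < f x) ⊆ A := Finset.filter_subset _ _
    have := hmin (y := A.filter (fun l => f l < f x)) ⟨hsub.trans hAs,
      ⟨q, Finset.mem_filter.2 ⟨hqA, hq.lt_of_ne (hfx q (hAs hqA))⟩⟩, ?_, ?_, ?_⟩ hsub hpA
    · exact (Finset.mem_filter.1 this).2.not_ge hp
    · intro h
      exact hcA (hsub (h ▸ hcs))
    · intro a ha b hb hbA
      obtain ⟨haA, ha⟩ := Finset.mem_filter.1 ha
      by_cases hb' : b ∈ A
      · have hbx : f x < f b := lt_of_le_of_ne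
          (not_lt.1 fun h => hbA (Finset.mem_filter.2 ⟨hb', h⟩)) (hfx b hb).symm
        refine lt_of_le_of_ne (hcon a haA ha b hb' hbx) ?_
        rintro rfl
        exact lt_asymm ha hbx
      · exact h1 a haA b hb hb'
    · intro a ha b hb hbA
      obtain ⟨haA, ha⟩ := Finset.mem_filter.1 ha
      by_cases hb' : b ∈ A
      · exact ha.trans_le (not_lt.1 fun h => hbA (Finset.mem_filter.2 ⟨hb', h⟩))
      · exact h2 a haA b hb hb'
  exact ⟨a, Finset.mem_insert_of_mem (hAs haA), b, Finset.mem_insert_of_mem (hAs hbA),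
    c, Finset.mem_insert_of_mem hcs, x, Finset.mem_insert_self _ _, hab, h1 b hbA c hcs hcA,
    hx c hcs, Or.inl ⟨hb, ha, h2 a haA c hcs hcA⟩⟩

/-- A permutation of length at least two avoiding `3142` and `2413` is a direct or a skew sum. -/
theorem hasSimplePattern_or_isDirectSplit {α β : Type*} [LinearOrder α] [LinearOrder β] (f : α → β)
    (s : Finset α) (hf : Set.InjOn f s) (hs : 2 ≤ s.card) :
    HasSimplePattern f s ∨ (∃ A, IsDirectSplit f s A) ∨
      ∃ A, IsDirectSplit (fun a => OrderDual.toDual (f a)) s A := by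
  induction s using Finset.induction_on_max with
  | empty => simp at hs
  | insert x s hx ih =>
    have hxs : x ∉ s := fun h => (hx x h).false
    have hfx : ∀ y ∈ s, f y ≠ f x := fun y hy h =>
      (hx y hy).ne (hf (by simp [hy]) (by simp) h)
    rw [Finset.card_insert_of_notMem hxs] at hs
    by_cases hs1 : s.card = 1
    · obtain ⟨y, rfl⟩ := Finset.card_eq_one.1 hs1
      have hyx : y < x := hx y (by simp)
      have key : ∀ b ∈ insert x ({y} : Finset α), b ∉ ({y} : Finset α) → b = x := by
        intro b hb hb'
        simpa [show b ≠ y by simpa using hb'] using hb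
      have hne : ({y} : Finset α) ≠ insert x {y} := fun h => hxs (h ▸ Finset.mem_insert_self _ _)
      rcases lt_or_gt_of_ne (hfx y (by simp)) with h | h
      · refine Or.inr (Or.inl ⟨{y}, by simp, by simp, hne, ?_, ?_⟩) <;>
        · intro a ha b hb hb'
          rw [Finset.mem_singleton.1 ha, key b hb hb']
          assumption
      · refine Or.inr (Or.inr ⟨{y}, by simp, by simp, hne, ?_, ?_⟩) <;>
        · intro a ha b hb hb'
          rw [Finset.mem_singleton.1 ha, key b hb hb']
          assumption
    · rcases ih (hf.mono (by simp)) (by omega) with h | h | h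
      · exact Or.inl (h.mono (Finset.subset_insert _ _))
      · exact isDirectSplit_insert f s x hx hfx h
      -- Reversing the order of values exchanges direct with skew sums and 3142 with 2413.
      · rcases isDirectSplit_insert (fun a => OrderDual.toDual (f a)) s x hx hfx h with h | h | h
        exacts [Or.inl h.of_toDual, Or.inr (Or.inr h), Or.inr (Or.inl h)]

/-! ### Walks along sequences and subdivisions from families of walks -/

theorem exists_walk_of_adj_succ {β : Type*} {K : SimpleGraph β} (x : ℕ → β) {a b : ℕ} (hab : a ≤ b)
    (h : ∀ i, a ≤ i → i < b → K.Adj (x i) (x (i + 1))) :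
    ∃ w : K.Walk (x a) (x b), w.support = (List.range' a (b + 1 - a)).map x ∧
      w.edges = (List.range' a (b - a)).map fun i => s(x i, x (i + 1)) := by
  induction b, hab using Nat.le_induction with
  | base => exact ⟨.nil, by simp, by simp⟩
  | succ b hab ih =>
    obtain ⟨w, hw, hw'⟩ := ih fun i hi hi' => h i hi (by omega)
    refine ⟨w.concat (h b hab (by omega)), ?_, ?_⟩
    · rw [SimpleGraph.Walk.support_concat, hw, show b + 1 + 1 - a = (b + 1 - a) + 1 by omega,
        List.range'_1_concat, List.map_append, show a + (b + 1 - a) = b + 1 by omega]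
      rfl
    · rw [SimpleGraph.Walk.edges_concat, hw', show b + 1 - a = (b - a) + 1 by omega,
        List.range'_1_concat, List.map_append, show a + (b - a) = b by omega]
      simp

theorem reachable_of_adj_succ {β : Type*} {K : SimpleGraph β} (x : ℕ → β) {a b : ℕ} (hab : a ≤ b)
    (h : ∀ i, a ≤ i → i < b → K.Adj (x i) (x (i + 1))) : K.Reachable (x a) (x b) :=
  ⟨(exists_walk_of_adj_succ x hab h).choose⟩

/-- A family of walks indexed by the edges of `P`, each with one chosen direction, exhibits a
subdivision of `P`. -/
theorem isSubdivisionOf_of_family {α β ι : Type*} (K : SimpleGraph β) (P : SimpleGraph α)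
    (f : α → β) (hf : Function.Injective f) (s t : ι → α)
    (hadj : ∀ a b, P.Adj a b → ∃ i, s(s i, t i) = s(a, b))
    (hinj : ∀ i j, s(s i, t i) = s(s j, t j) → i = j)
    (w : ∀ i, K.Walk (f (s i)) (f (t i))) (hpath : ∀ i, (w i).IsPath)
    (hadj' : ∀ i, P.Adj (s i) (t i))
    (hbranch : ∀ i c, f c ∈ (w i).support → c = s i ∨ c = t i)
    (hdisj : ∀ i j, i ≠ j → ∀ x, x ∈ (w i).support → x ∈ (w j).support → x ∈ Set.range f)
    (hverts : ∀ x, ∃ i, x ∈ (w i).support) (hedges : ∀ e ∈ K.edgeSet, ∃ i, e ∈ (w i).edges) :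
    IsSubdivisionOf K P := by
  classical
  have hor : ∀ a b, P.Adj a b → ¬ (∃ i, s i = a ∧ t i = b) → ∃ i, s i = b ∧ t i = a := by
    intro a b h h'
    obtain ⟨i, hi⟩ := hadj a b h
    rcases Sym2.eq_iff.1 hi with hi | hi
    exacts [(h' ⟨i, hi⟩).elim, ⟨i, hi⟩]
  -- A subdivision needs mutually reverse paths for the two directions of an edge. The given walk
  -- serves the direction in which the family lists the edge, its reverse the other; `hinj` makes
  -- the index found by choice the right one.
  let path : ∀ a b : α, P.Adj a b → K.Walk (f a) (f b) := fun a b h =>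
    if h' : ∃ i, s i = a ∧ t i = b then
      (w h'.choose).copy (congrArg f h'.choose_spec.1) (congrArg f h'.choose_spec.2)
    else
      ((w (hor a b h h').choose).copy (congrArg f (hor a b h h').choose_spec.1)
        (congrArg f (hor a b h h').choose_spec.2)).reverse
  have hpos : ∀ i (h : P.Adj (s i) (t i)), path (s i) (t i) h = w i := by
    intro i h
    have h' : ∃ j, s j = s i ∧ t j = t i := ⟨i, rfl, rfl⟩
    have key : ∀ j (h1 : s j = s i) (h2 : t j = t i),
        (w j).copy (congrArg f h1) (congrArg f h2) = w i := by
      intro j h1 h2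
      obtain rfl : j = i := hinj j i (by rw [h1, h2])
      rfl
    simp only [path, dif_pos h']
    exact key _ h'.choose_spec.1 h'.choose_spec.2
  have hneg : ∀ i (h : P.Adj (t i) (s i)), path (t i) (s i) h = (w i).reverse := by
    intro i h
    have h' : ¬ ∃ j, s j = t i ∧ t j = s i := by
      rintro ⟨j, h1, h2⟩
      obtain rfl : j = i := hinj j i (by rw [h1, h2, Sym2.eq_swap])
      exact h.ne h1.symm
    have key : ∀ j (h1 : s j = s i) (h2 : t j = t i),
        (w j).copy (congrArg f h1) (congrArg f h2) = w i := by
      intro j h1 h2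
      obtain rfl : j = i := hinj j i (by rw [h1, h2])
      rfl
    simp only [path, dif_neg h']
    rw [key _ (hor _ _ h h').choose_spec.1 (hor _ _ h h').choose_spec.2]
  have hcases : ∀ {motive : ∀ a b, P.Adj a b → Prop},
      (∀ i, motive (s i) (t i) (hadj' i)) → (∀ i, motive (t i) (s i) (hadj' i).symm) →
      ∀ a b h, motive a b h := by
    intro motive h1 h2 a b h
    obtain ⟨i, hi⟩ := hadj a b h
    rcases Sym2.eq_iff.1 hi with ⟨rfl, rfl⟩ | ⟨rfl, rfl⟩
    exacts [h1 i, h2 i]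
  have hfam : ∀ a b h, ∃ i, s(s i, t i) = s(a, b) ∧
      (∀ x, x ∈ (path a b h).support ↔ x ∈ (w i).support) := by
    apply hcases
    · exact fun i => ⟨i, rfl, fun x => by rw [hpos i (hadj' i)]⟩
    · exact fun i => ⟨i, Sym2.eq_swap, fun x => by simp [hneg i (hadj' i).symm]⟩
  refine ⟨f, path, hf, ?_, ?_, ?_, ?_, ?_, ?_⟩
  · apply hcases
    · intro i; rw [hpos i (hadj' i)]; exact hpath i
    · intro i; rw [hneg i (hadj' i).symm]; exact (hpath i).reverse
  · apply hcases
    · intro i; rw [hpos i (hadj' i), hneg i (hadj' i).symm]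
    · intro i; rw [hpos i (hadj' i), hneg i (hadj' i).symm, SimpleGraph.Walk.reverse_reverse]
  · intro a b h c hc
    obtain ⟨i, hi, hi'⟩ := hfam a b h
    have : c ∈ s(s i, t i) := Sym2.mem_iff.2 (hbranch i c ((hi' _).1 hc))
    rw [hi] at this
    exact Sym2.mem_iff.1 this
  · intro a b h c d h' hne x hx hx'
    obtain ⟨i, hi, hi'⟩ := hfam a b h
    obtain ⟨j, hj, hj'⟩ := hfam c d h'
    refine hdisj i j ?_ x ((hi' x).1 hx) ((hj' x).1 hx')
    rintro rfl
    exact hne (hi.symm.trans hj)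
  · intro x
    obtain ⟨i, hi⟩ := hverts x
    exact Or.inr ⟨s i, t i, hadj' i, by rwa [hpos i (hadj' i)]⟩
  · intro e he
    obtain ⟨i, hi⟩ := hedges e he
    exact ⟨s i, t i, hadj' i, by rwa [hpos i (hadj' i)]⟩

/-! ### Small cuts with a cycle on each side -/

/-- A non-bridge edge lies on a cycle, and that cycle stays inside one component. -/
theorem not_isTree_toSimpleGraph_of_reachable {β : Type*} {K : SimpleGraph β} {u v : β}
    (huv : K.Adj u v) (h : (K \ SimpleGraph.fromEdgeSet {s(u, v)}).Reachable u v) :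
    ¬ (K.connectedComponentMk u).toSimpleGraph.IsTree := by
  classical
  intro htree
  obtain ⟨w, p, hp, hmem⟩ :=
    SimpleGraph.adj_and_reachable_delete_edges_iff_exists_cycle.1 ⟨huv, h⟩
  have hsupp : ∀ z ∈ p.support, z ∈ (K.connectedComponentMk u).supp := by
    intro z hz
    rw [SimpleGraph.ConnectedComponent.mem_supp_iff, SimpleGraph.ConnectedComponent.eq]
    have hu := p.fst_mem_support_of_mem_edges hmem
    exact (p.takeUntil z hz).reachable.symm.trans (p.takeUntil u hu).reachable
  have hcyc : (p.induce _ hsupp).IsCycle := by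
    rw [← SimpleGraph.Walk.isCycle_map_iff_of_injective
      (f := (SimpleGraph.Embedding.induce (G := K) (K.connectedComponentMk u).supp).toHom)
      (SimpleGraph.Embedding.induce (G := K) _).injective]
    rw [SimpleGraph.Walk.map_induce]
    exact hp
  exact htree.isAcyclic _ hcyc

/-- In a cyclically `k`-edge-connected graph, the edges leaving a set `S` are at least `k` in number
if both `S` and its complement contain a non-bridge edge of the graph they induce. -/
theorem not_isCyclicallyEdgeConnected_of_cut {V : Type*} (G : SimpleGraph V) (k : ℕ) (S : Set V)
    (hcard : {e | e ∈ G.edgeSet ∧ ∃ u ∈ S, ∃ v ∈ Sᶜ, e = s(u, v)}.encard < k)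
    {u v u' v' : V} (hu : u ∈ S) (hv : v ∈ S) (huv : G.Adj u v)
    (hu' : u' ∉ S) (hv' : v' ∉ S) (huv' : G.Adj u' v')
    (h : ∀ K : SimpleGraph V,
      (∀ a ∈ S, ∀ b ∈ S, G.Adj a b → s(a, b) ≠ s(u, v) → K.Adj a b) → K.Reachable u v)
    (h' : ∀ K : SimpleGraph V,
      (∀ a ∉ S, ∀ b ∉ S, G.Adj a b → s(a, b) ≠ s(u', v') → K.Adj a b) → K.Reachable u' v') :
    ¬ IsCyclicallyEdgeConnected G k := by
  intro hconn
  set F : Set (Sym2 V) := {e | e ∈ G.edgeSet ∧ ∃ u ∈ S, ∃ v ∈ Sᶜ, e = s(u, v)} with hF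
  have hFS : ∀ a b, a ∈ S → b ∈ S → s(a, b) ∉ F := by
    rintro a b ha hb ⟨-, c, hc, d, hd, he⟩
    rcases Sym2.eq_iff.1 he with ⟨rfl, rfl⟩ | ⟨rfl, rfl⟩
    exacts [hd hb, hd ha]
  have hFS' : ∀ a b, a ∉ S → b ∉ S → s(a, b) ∉ F := by
    rintro a b ha hb ⟨-, c, hc, d, hd, he⟩
    rcases Sym2.eq_iff.1 he with ⟨rfl, rfl⟩ | ⟨rfl, rfl⟩
    exacts [ha hc, hb hc]
  refine hconn ⟨F, ⟨S, ⟨u, hu⟩, ⟨u', hu'⟩, rfl⟩, hcard,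
    (G.deleteEdges F).connectedComponentMk u, (G.deleteEdges F).connectedComponentMk u', ?_,
    not_isTree_toSimpleGraph_of_reachable (v := v) ?_ ?_,
    not_isTree_toSimpleGraph_of_reachable (v := v') ?_ ?_⟩
  -- A walk from `u` to `u'` must leave `S`, and the edge by which it leaves has been deleted.
  · intro heq
    obtain ⟨p⟩ := SimpleGraph.ConnectedComponent.exact heq
    obtain ⟨d, -, hd1, hd2⟩ := p.exists_boundary_dart S hu hu'
    have := d.adj
    rw [SimpleGraph.deleteEdges_adj] at this
    exact this.2 ⟨this.1, _, hd1, _, hd2, rfl⟩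
  · exact SimpleGraph.deleteEdges_adj.2 ⟨huv, hFS _ _ hu hv⟩
  -- Quantifying over all `K` in `h` expresses that `uv` is no bridge of the graph induced on `S`
  -- without passing to a subtype. Here `K` is `G` without the cut and without `uv`.
  · refine h _ fun a ha b hb hab hne => ?_
    simp [SimpleGraph.sdiff_adj, hab, hFS a b ha hb, hne]
  · exact SimpleGraph.deleteEdges_adj.2 ⟨huv', hFS' _ _ hu' hv'⟩
  · refine h' _ fun a ha b hb hab hne => ?_
    simp [SimpleGraph.sdiff_adj, hab, hFS' a b ha hb, hne]

/-! ### Cycles enumerated by indices, and their division into five segments -/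

/-- `x 0, …, x (n - 1)` are distinct and are in this cyclic order the vertices of a closed walk
of `K`. -/
structure IsCyclicEnum {β : Type*} (K : SimpleGraph β) (n : ℕ) (x : ℕ → β) : Prop where
  closed : x n = x 0
  inj : ∀ i < n, ∀ j < n, x i = x j → i = j
  adj : ∀ i < n, K.Adj (x i) (x (i + 1))

namespace IsCyclicEnum

variable {β : Type*} {K : SimpleGraph β} {n : ℕ} {x : ℕ → β}

theorem eq_or_of_apply_eq (hx : IsCyclicEnum K n x) {i j : ℕ} (hi : i < n) (hj : j ≤ n)
    (h : x i = x j) : i = j ∨ i = 0 ∧ j = n := by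
  rcases hj.lt_or_eq with hj | rfl
  · exact Or.inl (hx.inj i hi j hj h)
  · exact Or.inr ⟨hx.inj i hi 0 (by omega) (h.trans hx.closed), rfl⟩

theorem exists_lt_eq (hx : IsCyclicEnum K n x) (hn : 0 < n) {i : ℕ} (hi : i ≤ n) :
    ∃ j < n, x i = x j := by
  rcases hi.lt_or_eq with hi | rfl
  exacts [⟨i, hi, rfl⟩, ⟨0, hn, hx.closed⟩]

variable {t : Fin 6 → ℕ}

theorem apply_succ_eq (hx : IsCyclicEnum K n x) (h0 : t 0 = 0) (h5 : t 5 = n) (k : Fin 5) :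
    x (t k.succ) = x (t (k + 1).castSucc) := by
  fin_cases k
  · rfl
  · rfl
  · rfl
  · rfl
  · change x (t 5) = x (t 0)
    rw [h5, h0, hx.closed]

theorem lt_of_castSucc (ht : StrictMono t) (h5 : t 5 = n) (k : Fin 5) : t k.castSucc < n := by
  rw [← h5]
  exact ht (Fin.castSucc_lt_last k)

theorem succ_le (ht : StrictMono t) (h5 : t 5 = n) (k : Fin 5) : t k.succ ≤ n := by
  rw [← h5]
  exact ht.monotone (Fin.le_last _)

theorem exists_isPath_segment (hx : IsCyclicEnum K n x) (ht : StrictMono t) (h0 : t 0 = 0)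
    (h5 : t 5 = n) (k : Fin 5) :
    ∃ w : K.Walk (x (t k.castSucc)) (x (t (k + 1).castSucc)), w.IsPath ∧
      (∀ z, z ∈ w.support ↔ ∃ i, t k.castSucc ≤ i ∧ i ≤ t k.succ ∧ z = x i) ∧
      ∀ e, e ∈ w.edges ↔ ∃ i, t k.castSucc ≤ i ∧ i < t k.succ ∧ e = s(x i, x (i + 1)) := by
  have hlt : t k.castSucc < t k.succ := ht k.castSucc_lt_succ
  have hle := succ_le ht h5 k
  obtain ⟨w, hw, hw'⟩ := exists_walk_of_adj_succ (K := K) x hlt.le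
    fun i _ hi => hx.adj i (by omega)
  refine ⟨w.copy rfl (hx.apply_succ_eq h0 h5 k), ?_, ?_, ?_⟩
  · rw [SimpleGraph.Walk.isPath_copy, SimpleGraph.Walk.isPath_def, hw]
    refine List.Nodup.map_on ?_ List.nodup_range'
    -- The only repetition among `x 0, …, x n` is `x n = x 0`, so a segment is a path unless it runs
    -- from 0 to `n`.
    have hproper : ¬ (t k.castSucc = 0 ∧ t k.succ = n) := by
      rintro ⟨h, h'⟩
      rw [← h0] at h
      rw [← h5] at h'
      have h1 := congrArg Fin.val (ht.injective h)
      have h2 := congrArg Fin.val (ht.injective h')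
      simp at h1 h2
      omega
    intro i hi j hj h
    rw [List.mem_range'_1] at hi hj
    by_cases hin : i < n
    · rcases hx.eq_or_of_apply_eq hin (by omega) h with h | h <;> omega
    · by_cases hjn : j < n
      · rcases hx.eq_or_of_apply_eq hjn (by omega) h.symm with h | h <;> omega
      · omega
  · intro z
    simp only [SimpleGraph.Walk.support_copy, hw, List.mem_map, List.mem_range'_1]
    constructor
    · rintro ⟨i, hi, rfl⟩
      exact ⟨i, by omega, by omega, rfl⟩
    · rintro ⟨i, h1, h2, rfl⟩
      exact ⟨i, by omega, rfl⟩
  · intro z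
    simp only [SimpleGraph.Walk.edges_copy, hw', List.mem_map, List.mem_range'_1]
    constructor
    · rintro ⟨i, hi, rfl⟩
      exact ⟨i, by omega, by omega, rfl⟩
    · rintro ⟨i, h1, h2, rfl⟩
      exact ⟨i, by omega, rfl⟩

theorem injective_castSucc (hx : IsCyclicEnum K n x) (ht : StrictMono t) (h5 : t 5 = n) :
    Function.Injective fun k : Fin 5 => x (t k.castSucc) := fun _ _ h =>
  Fin.castSucc_injective _ (ht.injective
    (hx.inj _ (lt_of_castSucc ht h5 _) _ (lt_of_castSucc ht h5 _) h))

theorem eq_or_of_castSucc_mem (hx : IsCyclicEnum K n x) (ht : StrictMono t) (h0 : t 0 = 0)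
    (h5 : t 5 = n) {k c : Fin 5} {i : ℕ} (hi : t k.castSucc ≤ i) (hi' : i ≤ t k.succ)
    (h : x (t c.castSucc) = x i) : c = k ∨ c = k + 1 := by
  rcases hx.eq_or_of_apply_eq (lt_of_castSucc ht h5 c) (hi'.trans (succ_le ht h5 k)) h
    with rfl | ⟨hc, rfl⟩
  · rw [ht.le_iff_le] at hi hi'
    clear h
    decide +revert
  · rw [← h0] at hc
    rw [← h5] at hi'
    replace hc := ht.injective hc
    rw [ht.le_iff_le] at hi'
    clear h hi
    decide +revert

theorem exists_eq_castSucc_of_mem_segments (hx : IsCyclicEnum K n x) (ht : StrictMono t)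
    (h0 : t 0 = 0) (h5 : t 5 = n) {k l : Fin 5} (hkl : k ≠ l) {i j : ℕ} (hi : t k.castSucc ≤ i)
    (hi' : i ≤ t k.succ) (hj : t l.castSucc ≤ j) (hj' : j ≤ t l.succ) (h : x i = x j) :
    ∃ c : Fin 5, x (t c.castSucc) = x i := by
  rcases hi.eq_or_lt with rfl | hi
  · exact ⟨k, rfl⟩
  rcases hi'.eq_or_lt with rfl | hi'
  · exact ⟨k + 1, (hx.apply_succ_eq h0 h5 k).symm⟩
  rcases hj.eq_or_lt with rfl | hj
  · exact ⟨l, h.symm⟩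
  rcases hj'.eq_or_lt with rfl | hj'
  · exact ⟨l + 1, (hx.apply_succ_eq h0 h5 l).symm.trans h.symm⟩
  exfalso
  obtain rfl := hx.inj i (hi'.trans_le (succ_le ht h5 k)) j (hj'.trans_le (succ_le ht h5 l)) h
  have h1 := ht.lt_iff_lt.1 (hi.trans hj')
  have h2 := ht.lt_iff_lt.1 (hj.trans hi')
  rw [Fin.lt_def] at h1 h2
  simp at h1 h2
  omega

theorem exists_mem_segment (h0 : t 0 = 0) (h5 : t 5 = n) {i : ℕ} (hi : i < n) :
    ∃ k : Fin 5, t k.castSucc ≤ i ∧ i < t k.succ := by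
  by_contra! hcon
  have key : ∀ k : Fin 6, t k ≤ i := by
    intro k
    induction k using Fin.induction with
    | zero => rw [h0]; exact Nat.zero_le _
    | succ k ih => exact hcon k ih
  have := key 5
  omega

end IsCyclicEnum

/-! ### Recognising a subdivided Petersen graph -/

/-- Multiplication by 3 modulo 5, with inverse multiplication by 2, turns the pentagram step `+2`
into the step `+1` along the second cycle. So the inner vertex `k` sits at position `3 * k` of that
cycle. -/
theorem isSubdivisionOf_petersenGraph {β : Type*} {K : SimpleGraph β} {n m : ℕ} {x y : ℕ → β}
    (hx : IsCyclicEnum K n x) (hy : IsCyclicEnum K m y) (hxy : ∀ i < n, ∀ j < m, x i ≠ y j)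
    (hcover : ∀ v, (∃ i < n, v = x i) ∨ ∃ j < m, v = y j) {t r : Fin 6 → ℕ} (ht : StrictMono t)
    (ht0 : t 0 = 0) (ht5 : t 5 = n) (hr : StrictMono r) (hr0 : r 0 = 0) (hr5 : r 5 = m)
    (hspoke : ∀ k : Fin 5, K.Adj (x (t k.castSucc)) (y (r (3 * k).castSucc)))
    (hedge : ∀ e ∈ K.edgeSet, (∃ i < n, e = s(x i, x (i + 1))) ∨
      (∃ j < m, e = s(y j, y (j + 1))) ∨
      ∃ k : Fin 5, e = s(x (t k.castSucc), y (r (3 * k).castSucc))) :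
    IsSubdivisionOf K petersenGraph := by
  have hn : 0 < n := by rw [← ht0, ← ht5]; exact ht (by decide)
  have hm : 0 < m := by rw [← hr0, ← hr5]; exact hr (by decide)
  have hxy' : ∀ i ≤ n, ∀ j ≤ m, x i ≠ y j := by
    intro i hi j hj
    obtain ⟨i', hi', hii⟩ := hx.exists_lt_eq hn hi
    obtain ⟨j', hj', hjj⟩ := hy.exists_lt_eq hm hj
    rw [hii, hjj]
    exact hxy i' hi' j' hj'
  have h32 : ∀ k : Fin 5, 3 * (2 * k) = k := by decide
  have h23 : ∀ k : Fin 5, 2 * (3 * k) = k := by decide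
  have hinj : let s' : Fin 5 ⊕ Fin 5 ⊕ Fin 5 → Fin 5 ⊕ Fin 5 :=
      Sum.elim Sum.inl (Sum.elim Sum.inl fun k => Sum.inr (2 * k))
    let t' : Fin 5 ⊕ Fin 5 ⊕ Fin 5 → Fin 5 ⊕ Fin 5 :=
      Sum.elim (fun k => Sum.inl (k + 1)) (Sum.elim Sum.inr fun k => Sum.inr (2 * (k + 1)))
    ∀ i j, s(s' i, t' i) = s(s' j, t' j) → i = j := by
    intro s' t'
    decide
  let f : Fin 5 ⊕ Fin 5 → β :=
    Sum.elim (fun k => x (t k.castSucc)) fun k => y (r (3 * k).castSucc)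
  let s' : Fin 5 ⊕ Fin 5 ⊕ Fin 5 → Fin 5 ⊕ Fin 5 :=
    Sum.elim Sum.inl (Sum.elim Sum.inl fun k => Sum.inr (2 * k))
  let t' : Fin 5 ⊕ Fin 5 ⊕ Fin 5 → Fin 5 ⊕ Fin 5 :=
    Sum.elim (fun k => Sum.inl (k + 1)) (Sum.elim Sum.inr fun k => Sum.inr (2 * (k + 1)))
  -- The three summands index the five segments of the first cycle, the five spokes, and the five
  -- segments of the second cycle.
  let supp : Fin 5 ⊕ Fin 5 ⊕ Fin 5 → β → Prop :=
    Sum.elim (fun k z => ∃ i, t k.castSucc ≤ i ∧ i ≤ t k.succ ∧ z = x i)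
      (Sum.elim (fun k z => z = x (t k.castSucc) ∨ z = y (r (3 * k).castSucc))
        fun k z => ∃ i, r k.castSucc ≤ i ∧ i ≤ r k.succ ∧ z = y i)
  let edg : Fin 5 ⊕ Fin 5 ⊕ Fin 5 → Sym2 β → Prop :=
    Sum.elim (fun k e => ∃ i, t k.castSucc ≤ i ∧ i < t k.succ ∧ e = s(x i, x (i + 1)))
      (Sum.elim (fun k e => e = s(x (t k.castSucc), y (r (3 * k).castSucc)))
        fun k e => ∃ i, r k.castSucc ≤ i ∧ i < r k.succ ∧ e = s(y i, y (i + 1)))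
  have hw : ∀ i, ∃ w : K.Walk (f (s' i)) (f (t' i)), w.IsPath ∧
      (∀ z, z ∈ w.support ↔ supp i z) ∧ ∀ e, e ∈ w.edges ↔ edg i e := by
    rintro (k | k | k)
    · exact hx.exists_isPath_segment ht ht0 ht5 k
    · have h : ∃ w : K.Walk (x (t k.castSucc)) (y (r (3 * k).castSucc)), w.IsPath ∧
          (∀ z, z ∈ w.support ↔ z = x (t k.castSucc) ∨ z = y (r (3 * k).castSucc)) ∧
          ∀ e, e ∈ w.edges ↔ e = s(x (t k.castSucc), y (r (3 * k).castSucc)) :=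
        ⟨(hspoke k).toWalk, by simp [(hspoke k).ne], by simp, by simp⟩
      exact h
    · obtain ⟨w, h1, h2, h3⟩ := hy.exists_isPath_segment hr hr0 hr5 k
      refine ⟨w.copy ?_ ?_, ?_, ?_, ?_⟩
      · simp [f, s', h32]
      · simp only [f, t', Sum.elim_inr, h32]
      · simpa using h1
      · intro z
        rw [SimpleGraph.Walk.support_copy]
        exact h2 z
      · intro e
        rw [SimpleGraph.Walk.edges_copy]
        exact h3 e
  choose w hpath hsupp hedg using hw
  have hrangex : ∀ c : Fin 5, x (t c.castSucc) ∈ Set.range f := fun c => ⟨Sum.inl c, rfl⟩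
  have hrangey : ∀ c : Fin 5, y (r c.castSucc) ∈ Set.range f := fun c =>
    ⟨Sum.inr (2 * c), by simp [f, h32]⟩
  have hlex : ∀ {k : Fin 5} {i}, i ≤ t k.succ → i ≤ n :=
    fun h => h.trans (IsCyclicEnum.succ_le ht ht5 _)
  have hley : ∀ {k : Fin 5} {i}, i ≤ r k.succ → i ≤ m :=
    fun h => h.trans (IsCyclicEnum.succ_le hr hr5 _)
  have hlx : ∀ k : Fin 5, t k.castSucc ≤ n := fun k => (IsCyclicEnum.lt_of_castSucc ht ht5 k).le
  have hly : ∀ k : Fin 5, r k.castSucc ≤ m := fun k => (IsCyclicEnum.lt_of_castSucc hr hr5 k).le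
  refine isSubdivisionOf_of_family K petersenGraph f ?_ s' t' ?_ ?_ w hpath ?_ ?_ ?_ ?_ ?_
  · rintro (a | a) (b | b) h
    · exact congrArg _ (hx.injective_castSucc ht ht5 h)
    · exact (hxy' _ (hlx _) _ (hly _) h).elim
    · exact (hxy' _ (hlx _) _ (hly _) h.symm).elim
    · have h := hy.injective_castSucc hr hr5 h
      rw [← h23 a, h, h23]
  · rintro (a | a) (b | b) h
    · rcases h with rfl | rfl
      exacts [⟨Sum.inl a, rfl⟩, ⟨Sum.inl b, Sym2.eq_swap⟩]
    · obtain rfl : a = b := h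
      exact ⟨Sum.inr (Sum.inl a), rfl⟩
    · obtain rfl : a = b := h
      exact ⟨Sum.inr (Sum.inl a), Sym2.eq_swap⟩
    · have h2 : ∀ k : Fin 5, 2 * (3 * k + 1) = k + 2 := by decide
      rcases h with rfl | rfl
      · exact ⟨Sum.inr (Sum.inr (3 * a)), by simp only [s', t', Sum.elim_inr, h23, h2]⟩
      · exact ⟨Sum.inr (Sum.inr (3 * b)), by
          simp only [s', t', Sum.elim_inr, h23, h2]; exact Sym2.eq_swap⟩
  · exact hinj
  · rintro (k | k | k)
    · exact Or.inl rfl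
    · exact rfl
    · exact Or.inl (by rw [mul_add]; rfl)
  · rintro (k | k | k) (c | c) hc <;> rw [hsupp] at hc
    · obtain ⟨i, h1, h2, h3⟩ := hc
      rcases hx.eq_or_of_castSucc_mem ht ht0 ht5 h1 h2 h3 with rfl | rfl
      exacts [Or.inl rfl, Or.inr rfl]
    · obtain ⟨i, h1, h2, h3⟩ := hc
      exact (hxy' i (hlex h2) _ (hly _) h3.symm).elim
    · rcases hc with hc | hc
      · exact Or.inl (congrArg _ (hx.injective_castSucc ht ht5 hc))
      · exact (hxy' _ (hlx _) _ (hly _) hc).elim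
    · rcases hc with hc | hc
      · exact (hxy' _ (hlx _) _ (hly _) hc.symm).elim
      · have h := hy.injective_castSucc hr hr5 hc
        right
        change Sum.inr c = Sum.inr k
        rw [← h23 c, h, h23]
    · obtain ⟨i, h1, h2, h3⟩ := hc
      exact (hxy' _ (hlx _) i (hley h2) h3).elim
    · obtain ⟨i, h1, h2, h3⟩ := hc
      have h := hy.eq_or_of_castSucc_mem hr hr0 hr5 h1 h2 h3
      rw [← h23 c]
      rcases h with h | h <;> rw [h]
      exacts [Or.inl rfl, Or.inr rfl]
  · rintro (k | k | k) (l | l | l) hne z hz hz' <;> rw [hsupp] at hz hz'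
    · obtain ⟨i, h1, h2, rfl⟩ := hz
      obtain ⟨j, h3, h4, h⟩ := hz'
      obtain ⟨c, hc⟩ := hx.exists_eq_castSucc_of_mem_segments ht ht0 ht5
        (fun h => hne (congrArg _ h)) h1 h2 h3 h4 h
      exact hc ▸ hrangex c
    · rcases hz' with rfl | rfl
      exacts [hrangex _, hrangey _]
    · obtain ⟨i, h1, h2, rfl⟩ := hz
      obtain ⟨j, h3, h4, h⟩ := hz'
      exact (hxy' i (hlex h2) j (hley h4) h).elim
    · rcases hz with rfl | rfl
      exacts [hrangex _, hrangey _]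
    · rcases hz with rfl | rfl
      exacts [hrangex _, hrangey _]
    · rcases hz with rfl | rfl
      exacts [hrangex _, hrangey _]
    · obtain ⟨i, h1, h2, rfl⟩ := hz
      obtain ⟨j, h3, h4, h⟩ := hz'
      exact (hxy' j (hlex h4) i (hley h2) h.symm).elim
    · rcases hz' with rfl | rfl
      exacts [hrangex _, hrangey _]
    · obtain ⟨i, h1, h2, rfl⟩ := hz
      obtain ⟨j, h3, h4, h⟩ := hz'
      obtain ⟨c, hc⟩ := hy.exists_eq_castSucc_of_mem_segments hr hr0 hr5
        (fun h => hne (congrArg (fun k => Sum.inr (Sum.inr k)) h)) h1 h2 h3 h4 h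
      exact hc ▸ hrangey c
  · intro z
    rcases hcover z with ⟨i, hi, rfl⟩ | ⟨i, hi, rfl⟩
    · obtain ⟨k, hk, hk'⟩ := IsCyclicEnum.exists_mem_segment ht0 ht5 hi
      exact ⟨Sum.inl k, (hsupp _ _).2 ⟨i, hk, hk'.le, rfl⟩⟩
    · obtain ⟨k, hk, hk'⟩ := IsCyclicEnum.exists_mem_segment hr0 hr5 hi
      exact ⟨Sum.inr (Sum.inr k), (hsupp _ _).2 ⟨i, hk, hk'.le, rfl⟩⟩
  · intro e he
    rcases hedge e he with ⟨i, hi, rfl⟩ | ⟨i, hi, rfl⟩ | ⟨k, rfl⟩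
    · obtain ⟨k, hk, hk'⟩ := IsCyclicEnum.exists_mem_segment ht0 ht5 hi
      exact ⟨Sum.inl k, (hedg _ _).2 ⟨i, hk, hk', rfl⟩⟩
    · obtain ⟨k, hk, hk'⟩ := IsCyclicEnum.exists_mem_segment hr0 hr5 hi
      exact ⟨Sum.inr (Sum.inr k), (hedg _ _).2 ⟨i, hk, hk', rfl⟩⟩
    · exact ⟨Sum.inr (Sum.inl k), (hedg _ _).2 rfl⟩

/-! ### Enumerated marked permutation graphs -/

theorem IsCycleSubgraph.exists_isCyclicEnum {V : Type*} {G : SimpleGraph V} {C : G.Subgraph}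
    (hC : IsCycleSubgraph C) {u : V} (hu : u ∈ C.verts) :
    ∃ (n : ℕ) (x : ℕ → V), 3 ≤ n ∧ x 0 = u ∧ IsCyclicEnum G n x ∧
      (∀ v, v ∈ C.verts ↔ ∃ i < n, v = x i) ∧
      ∀ a b, C.Adj a b ↔ ∃ i < n, s(a, b) = s(x i, x (i + 1)) := by
  classical
  obtain ⟨v, p, hp, rfl⟩ := hC
  rw [SimpleGraph.Walk.mem_verts_toSubgraph] at hu
  rw [← SimpleGraph.Walk.toSubgraph_rotate p hu]
  have hq := hp.rotate hu
  generalize p.rotate u hu = q at hq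
  have h3 := hq.three_le_length
  refine ⟨q.length, q.getVert, h3, q.getVert_zero, ⟨?_, ?_, ?_⟩, ?_, ?_⟩
  · rw [q.getVert_length, q.getVert_zero]
  · intro i hi j hj h
    exact hq.getVert_injOn' (by rw [Set.mem_ofPred_eq]; omega) (by rw [Set.mem_ofPred_eq]; omega) h
  · intro i hi
    exact q.adj_getVert_succ hi
  · intro v
    rw [SimpleGraph.Walk.mem_verts_toSubgraph, SimpleGraph.Walk.mem_support_iff_exists_getVert]
    constructor
    · rintro ⟨i, rfl, hi⟩
      rcases hi.lt_or_eq with hi | rfl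
      · exact ⟨i, hi, rfl⟩
      · exact ⟨0, by omega, by rw [q.getVert_length, q.getVert_zero]⟩
    · rintro ⟨i, hi, rfl⟩
      exact ⟨i, rfl, hi.le⟩
  · intro a b
    rw [SimpleGraph.Walk.toSubgraph_adj_iff]
    constructor
    · rintro ⟨i, h, hi⟩
      exact ⟨i, hi, h.symm⟩
    · rintro ⟨i, hi, h⟩
      exact ⟨i, h.symm, hi⟩

/-- `x` and `y` enumerate in cyclic order two disjoint cycles that together with the perfect
matching `M` make up `G`, and `x 0` is matched to `y 0`. -/
structure IsMarkedEnum {V : Type*} {G : SimpleGraph V} (M : G.Subgraph) (n m : ℕ) (x y : ℕ → V) :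
    Prop where
  left : IsCyclicEnum G n x
  right : IsCyclicEnum G m y
  three_le_left : 3 ≤ n
  three_le_right : 3 ≤ m
  ne : ∀ i ≤ n, ∀ j ≤ m, x i ≠ y j
  cover : ∀ v, (∃ i < n, v = x i) ∨ ∃ j < m, v = y j
  edge : ∀ a b, G.Adj a b → M.Adj a b ∨ (∃ i < n, s(a, b) = s(x i, x (i + 1))) ∨
    ∃ j < m, s(a, b) = s(y j, y (j + 1))
  not_adj_left : ∀ i < n, ¬ M.Adj (x i) (x (i + 1))
  not_adj_right : ∀ j < m, ¬ M.Adj (y j) (y (j + 1))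
  exists_right : ∀ i < n, ∃ j < m, M.Adj (x i) (y j)
  exists_left : ∀ j < m, ∃ i < n, M.Adj (x i) (y j)
  unique : ∀ a b c, M.Adj a b → M.Adj a c → b = c
  base : M.Adj (x 0) (y 0)

theorem IsCyclicEnum.reverse {β : Type*} {K : SimpleGraph β} {n : ℕ} {x : ℕ → β}
    (hx : IsCyclicEnum K n x) : IsCyclicEnum K n fun i => x (n - i) where
  closed := by simp [hx.closed]
  inj i hi j hj h := by
    rcases Nat.eq_zero_or_pos i with rfl | hi0
    · by_contra hne
      rcases hx.eq_or_of_apply_eq (j := n - 0) (by omega) (by omega) h.symm with h | h <;> omega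
    · rcases hx.eq_or_of_apply_eq (i := n - i) (by omega) (by omega) h with h | h <;> omega
  adj i hi := by
    have h := (hx.adj (n - (i + 1)) (by omega)).symm
    rwa [show n - (i + 1) + 1 = n - i by omega] at h

theorem IsCyclicEnum.mk_ne_mk_zero_one {β : Type*} {K : SimpleGraph β} {n : ℕ} {x : ℕ → β}
    (hx : IsCyclicEnum K n x) (hn : 3 ≤ n) {i : ℕ} (hi : 1 ≤ i) (hi' : i < n) :
    s(x i, x (i + 1)) ≠ s(x 0, x 1) := by
  intro h
  rcases Sym2.eq_iff.1 h with ⟨h, -⟩ | ⟨h, h'⟩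
  · have := hx.inj i hi' 0 (by omega) h
    omega
  · obtain rfl := hx.inj i hi' 1 (by omega) h
    have := hx.inj 2 (by omega) 0 (by omega) h'
    omega

namespace IsMarkedEnum

variable {V : Type*} {G : SimpleGraph V} {M : G.Subgraph} {n m : ℕ} {x y : ℕ → V}

/-- Reduces the pattern 2413 to 3142; the base edge is kept because `y m = y 0`. -/
theorem reverse_right (h : IsMarkedEnum M n m x y) :
    IsMarkedEnum M n m x fun j => y (m - j) where
  left := h.left
  right := h.right.reverse
  three_le_left := h.three_le_left
  three_le_right := h.three_le_right
  ne i hi j _ := h.ne i hi _ (Nat.sub_le _ _)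
  cover v := by
    rcases h.cover v with hv | ⟨j, hj, rfl⟩
    · exact Or.inl hv
    right
    rcases Nat.eq_zero_or_pos j with rfl | hj0
    · exact ⟨0, hj, by simp [h.right.closed]⟩
    · exact ⟨m - j, by omega, by rw [Nat.sub_sub_self hj.le]⟩
  edge a b hab := by
    rcases h.edge a b hab with h' | h' | ⟨j, hj, h'⟩
    · exact Or.inl h'
    · exact Or.inr (Or.inl h')
    · refine Or.inr (Or.inr ⟨m - (j + 1), by omega, ?_⟩)
      rw [h', Nat.sub_sub_self (by omega), show m - (m - (j + 1) + 1) = j by omega, Sym2.eq_swap]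
  not_adj_left := h.not_adj_left
  not_adj_right j hj hadj := by
    refine h.not_adj_right (m - (j + 1)) (by omega) ?_
    rw [show m - (j + 1) + 1 = m - j by omega]
    exact hadj.symm
  exists_right i hi := by
    obtain ⟨j, hj, hadj⟩ := h.exists_right i hi
    rcases Nat.eq_zero_or_pos j with rfl | hj0
    · exact ⟨0, hj, by simpa [h.right.closed] using hadj⟩
    · exact ⟨m - j, by omega, by rwa [Nat.sub_sub_self hj.le]⟩
  exists_left j hj := by
    rcases Nat.eq_zero_or_pos j with rfl | hj0
    · simpa [h.right.closed] using h.exists_left 0 hj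
    · exact h.exists_left (m - j) (by omega)
  unique := h.unique
  base := by simpa [h.right.closed] using h.base

theorem left_eq (h : IsMarkedEnum M n m x y) {i i' j : ℕ} (hi : i < n) (hi' : i' < n)
    (h1 : M.Adj (x i) (y j)) (h2 : M.Adj (x i') (y j)) : i = i' :=
  h.left.inj i hi i' hi' (h.unique _ _ _ h1.symm h2.symm)

theorem right_eq (h : IsMarkedEnum M n m x y) {i j j' : ℕ} (hj : j < m) (hj' : j' < m)
    (h1 : M.Adj (x i) (y j)) (h2 : M.Adj (x i) (y j')) : j = j' :=
  h.right.inj j hj j' hj' (h.unique _ _ _ h1 h2)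

/-- The order `b' < d' < a' < c'` is the pattern 3142. Along the second cycle the spokes appear as
`0, b, d, a, c`, so spoke `k` ends at position `3 * k` modulo 5. -/
theorem exists_isPetersenCopy (h : IsMarkedEnum M n m x y) {a b c d a' b' c' d' : ℕ}
    (h0a : 0 < a) (hab : a < b) (hbc : b < c) (hcd : c < d) (hdn : d < n)
    (h0b' : 0 < b') (hbd' : b' < d') (hda' : d' < a') (hac' : a' < c') (hcm' : c' < m)
    (ha : M.Adj (x a) (y a')) (hb : M.Adj (x b) (y b')) (hc : M.Adj (x c) (y c'))
    (hd : M.Adj (x d) (y d')) :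
    ∃ H : G.Subgraph, IsPetersenCopy M H ∧ s(x 0, y 0) ∈ H.edgeSet := by
  classical
  let t : Fin 6 → ℕ := ![0, a, b, c, d, n]
  let r : Fin 6 → ℕ := ![0, b', d', a', c', m]
  have ht : StrictMono t := by
    rw [Fin.strictMono_iff_lt_succ]
    intro k
    fin_cases k <;> assumption
  have hr : StrictMono r := by
    rw [Fin.strictMono_iff_lt_succ]
    intro k
    fin_cases k <;> assumption
  have hspoke : ∀ k : Fin 5, M.Adj (x (t k.castSucc)) (y (r (3 * k).castSucc)) := by
    intro k
    fin_cases k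
    exacts [h.base, ha, hb, hc, hd]
  let g : Fin 5 → Sym2 V := fun k => s(x (t k.castSucc), y (r (3 * k).castSucc))
  have hg : Function.Injective g := by
    intro k l hkl
    rcases Sym2.eq_iff.1 hkl with ⟨h1, -⟩ | ⟨h1, -⟩
    · exact h.left.injective_castSucc ht rfl h1
    · exact (h.ne _ (IsCyclicEnum.lt_of_castSucc ht rfl k).le _
        (IsCyclicEnum.lt_of_castSucc hr rfl _).le h1).elim
  let S : Finset (Sym2 V) := Finset.univ.image g
  let H : G.Subgraph :=
    { verts := Set.univ
      Adj := fun u v => G.Adj u v ∧ (M.Adj u v → s(u, v) ∈ S)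
      adj_sub := fun h => h.1
      edge_vert := fun _ => Set.mem_univ _
      symm := ⟨fun u v h => ⟨h.1.symm, fun h' => Sym2.eq_swap ▸ h.2 h'.symm⟩⟩ }
  have hSM : (S : Set (Sym2 V)) ⊆ M.edgeSet := by
    intro e he
    obtain ⟨k, -, rfl⟩ := Finset.mem_image.1 he
    exact hspoke k
  have hedgeSet : H.edgeSet = (G.edgeSet \ M.edgeSet) ∪ S := by
    ext e
    induction e using Sym2.ind with
    | _ u v =>
      constructor
      · rintro ⟨h1, h2⟩
        by_cases h3 : M.Adj u v
        exacts [Or.inr (h2 h3), Or.inl ⟨h1, h3⟩]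
      · rintro (⟨h1, h2⟩ | h1)
        · exact ⟨h1, fun h3 => (h2 h3).elim⟩
        · exact ⟨M.adj_sub (hSM h1), fun _ => h1⟩
  have hHx : ∀ i < n, H.Adj (x i) (x (i + 1)) := fun i hi =>
    ⟨h.left.adj i hi, fun h' => (h.not_adj_left i hi h').elim⟩
  have hHy : ∀ j < m, H.Adj (y j) (y (j + 1)) := fun j hj =>
    ⟨h.right.adj j hj, fun h' => (h.not_adj_right j hj h').elim⟩
  have hHs : ∀ k : Fin 5, H.Adj (x (t k.castSucc)) (y (r (3 * k).castSucc)) := fun k =>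
    ⟨M.adj_sub (hspoke k), fun _ => Finset.mem_image_of_mem g (Finset.mem_univ k)⟩
  refine ⟨H, ⟨?_, S, hSM, ?_, rfl, hedgeSet⟩, hHs 0⟩
  · refine isSubdivisionOf_petersenGraph (K := H.coe) (n := n) (m := m)
      (x := fun i => ⟨x i, Set.mem_univ _⟩) (y := fun j => ⟨y j, Set.mem_univ _⟩)
      ⟨Subtype.ext h.left.closed, fun i hi j hj hij => h.left.inj i hi j hj (congrArg Subtype.val hij),
        hHx⟩
      ⟨Subtype.ext h.right.closed,
        fun i hi j hj hij => h.right.inj i hi j hj (congrArg Subtype.val hij), hHy⟩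
      (fun i hi j hj hij => h.ne i hi.le j hj.le (congrArg Subtype.val hij)) ?_
      ht rfl rfl hr rfl rfl hHs ?_
    · rintro ⟨v, -⟩
      rcases h.cover v with ⟨i, hi, rfl⟩ | ⟨i, hi, rfl⟩
      exacts [Or.inl ⟨i, hi, rfl⟩, Or.inr ⟨i, hi, rfl⟩]
    · have hval : Function.Injective (Sym2.map (Subtype.val : H.verts → V)) :=
        Sym2.map.injective Subtype.val_injective
      intro e he
      induction e using Sym2.ind with
      | _ u v =>
        have hadj : H.Adj u.1 v.1 := he
        rcases h.edge _ _ hadj.1 with h' | ⟨i, hi, h'⟩ | ⟨i, hi, h'⟩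
        · obtain ⟨k, -, hk⟩ := Finset.mem_image.1 (hadj.2 h')
          exact Or.inr (Or.inr ⟨k, hval hk.symm⟩)
        · exact Or.inl ⟨i, hi, hval h'⟩
        · exact Or.inr (Or.inl ⟨i, hi, hval h'⟩)
  · rw [Finset.card_image_of_injective _ hg, Finset.card_univ, Fintype.card_fin]

/-- The `n` matching edges form the cut between the two cycles, each of which survives on its own
side. -/
theorem five_le (h : IsMarkedEnum M n m x y) (hG : IsCyclicallyEdgeConnected G 5) : 5 ≤ n := by
  classical
  by_contra! hn
  have h3 := h.three_le_left
  have h3' := h.three_le_right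
  choose! f hf hadj using h.exists_right
  refine not_isCyclicallyEdgeConnected_of_cut G 5 {v | ∃ i < n, v = x i} ?_ (u := x 0) (v := x 1)
    (u' := y 0) (v' := y 1) ⟨0, by omega, rfl⟩ ⟨1, by omega, rfl⟩ (h.left.adj 0 (by omega))
    ?_ ?_ (h.right.adj 0 (by omega)) ?_ ?_ hG
  · have hsub : {e | e ∈ G.edgeSet ∧ ∃ u ∈ {v | ∃ i < n, v = x i},
        ∃ v ∈ {v | ∃ i < n, v = x i}ᶜ, e = s(u, v)} ⊆
        ((Finset.range n).image fun i => s(x i, y (f i)) : Finset (Sym2 V)) := by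
      rintro e ⟨he, u, ⟨i, hi, rfl⟩, v, hv, rfl⟩
      have hvx : ∀ j ≤ n, v ≠ x j := by
        rintro j hj rfl
        exact hv (h.left.exists_lt_eq (by omega) hj)
      rcases h.edge _ _ he with h' | ⟨j, hj, h'⟩ | ⟨j, hj, h'⟩
      · obtain rfl := h.unique _ _ _ h' (hadj i hi)
        exact Finset.mem_coe.2 (Finset.mem_image.2 ⟨i, Finset.mem_range.2 hi, rfl⟩)
      · rcases Sym2.eq_iff.1 h' with ⟨-, h'⟩ | ⟨-, h'⟩
        exacts [(hvx _ hj h').elim, (hvx _ hj.le h').elim]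
      · rcases Sym2.eq_iff.1 h' with ⟨h', -⟩ | ⟨h', -⟩
        exacts [(h.ne _ hi.le _ hj.le h').elim, (h.ne _ hi.le _ hj h').elim]
    refine (Set.encard_le_encard hsub).trans_lt ?_
    rw [Set.encard_coe_eq_coe_finsetCard]
    have := Finset.card_image_le (s := Finset.range n) (f := fun i => s(x i, y (f i)))
    rw [Finset.card_range] at this
    exact_mod_cast this.trans_lt hn
  · rintro ⟨i, hi, h'⟩
    exact h.ne i hi.le 0 (by omega) h'.symm
  · rintro ⟨i, hi, h'⟩
    exact h.ne i hi.le 1 (by omega) h'.symm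
  · intro K hK
    have := reachable_of_adj_succ (K := K) x (a := 1) (b := n) (by omega) fun i hi hi' =>
      hK _ ⟨i, hi', rfl⟩ _ (h.left.exists_lt_eq (by omega) (by omega)) (h.left.adj i hi')
        (h.left.mk_ne_mk_zero_one h3 hi hi')
    rw [h.left.closed] at this
    exact this.symm
  · intro K hK
    have hy : ∀ j ≤ m, y j ∉ {v | ∃ i < n, v = x i} := by
      rintro j hj ⟨i, hi, h'⟩
      exact h.ne i hi.le j hj h'.symm
    have := reachable_of_adj_succ (K := K) y (a := 1) (b := m) (by omega) fun i hi hi' =>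
      hK _ (hy i hi'.le) _ (hy _ hi') (h.right.adj i hi')
        (h.right.mk_ne_mk_zero_one h3' hi hi')
    rw [h.right.closed] at this
    exact this.symm

end IsMarkedEnum

/-! ### Four-edge cuts from matched intervals -/

theorem reachable_zero_of_adj_succ_outside {β : Type*} {K : SimpleGraph β} {x : ℕ → β} {n a b : ℕ}
    (hclosed : x n = x 0)
    (hadj : ∀ i < n, ¬ (a ≤ i ∧ i ≤ b) → ¬ (a ≤ i + 1 ∧ i + 1 ≤ b) → K.Adj (x i) (x (i + 1)))
    {z : ℕ} (hz : z < n) (hz' : ¬ (a ≤ z ∧ z ≤ b)) : K.Reachable (x 0) (x z) := by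
  by_cases hza : z < a
  · exact reachable_of_adj_succ x (Nat.zero_le z) fun i _ hi =>
      hadj i (by omega) (by omega) (by omega)
  · rw [← hclosed]
    exact (reachable_of_adj_succ x hz.le fun i hi hi' =>
      hadj i hi' (by omega) (by omega)).symm

/-- The cut separates the two matched intervals from the rest. Inside, the matching edges at `x a`
and `x b` close up a cycle with the cycle segments between them; outside, those at `x 0` and `x z`
do. -/
theorem IsMarkedEnum.not_isCyclicallyEdgeConnected {V : Type*} {G : SimpleGraph V}
    {M : G.Subgraph} {n m : ℕ} {x y : ℕ → V} (h : IsMarkedEnum M n m x y) {a b c d z : ℕ}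
    (ha : 1 ≤ a) (hab : a < b) (hb : b < n) (hz : 1 ≤ z) (hzn : z < n) (hz' : ¬ (a ≤ z ∧ z ≤ b))
    (hc : 1 ≤ c) (hd : d < m)
    (hM : ∀ i < n, ∀ j < m, M.Adj (x i) (y j) → (a ≤ i ∧ i ≤ b ↔ c ≤ j ∧ j ≤ d)) :
    ¬ IsCyclicallyEdgeConnected G 5 := by
  classical
  have h3 := h.three_le_right
  let S : Set V := {v | (∃ i, a ≤ i ∧ i ≤ b ∧ v = x i) ∨ ∃ j, c ≤ j ∧ j ≤ d ∧ v = y j}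
  have hSx : ∀ i ≤ n, x i ∈ S ↔ a ≤ i ∧ i ≤ b := by
    intro i hi
    constructor
    · rintro (⟨j, h1, h2, h'⟩ | ⟨j, h1, h2, h'⟩)
      · rcases h.left.eq_or_of_apply_eq (by omega) hi h'.symm with h'' | h'' <;> omega
      · exact (h.ne i hi j (by omega) h').elim
    · rintro ⟨h1, h2⟩
      exact Or.inl ⟨i, h1, h2, rfl⟩
  have hSy : ∀ j ≤ m, y j ∈ S ↔ c ≤ j ∧ j ≤ d := by
    intro i hi
    constructor
    · rintro (⟨j, h1, h2, h'⟩ | ⟨j, h1, h2, h'⟩)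
      · exact (h.ne j (by omega) i hi h'.symm).elim
      · rcases h.right.eq_or_of_apply_eq (by omega) hi h'.symm with h'' | h'' <;> omega
    · rintro ⟨h1, h2⟩
      exact Or.inr ⟨i, h1, h2, rfl⟩
  have hneM : ∀ {i j k l}, i ≤ n → j ≤ n → l ≤ m → s(x i, x j) ≠ s(x k, y l) := by
    intro i j k l hi hj hl h'
    rcases Sym2.eq_iff.1 h' with ⟨-, h'⟩ | ⟨h', -⟩
    exacts [h.ne _ hj _ hl h', h.ne _ hi _ hl h']
  have hneM' : ∀ {i j k l}, i ≤ m → j ≤ m → k ≤ n → s(y i, y j) ≠ s(x k, y l) := by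
    intro i j k l hi hj hk h'
    rcases Sym2.eq_iff.1 h' with ⟨h', -⟩ | ⟨-, h'⟩
    exacts [h.ne _ hk _ hi h'.symm, h.ne _ hk _ hj h'.symm]
  obtain ⟨a', ha', haa⟩ := h.exists_right a (by omega)
  obtain ⟨b', hb', hbb⟩ := h.exists_right b hb
  obtain ⟨z', hz'm, hzz⟩ := h.exists_right z hzn
  have hac := (hM a (by omega) a' ha' haa).1 ⟨le_rfl, hab.le⟩
  have hbc := (hM b hb b' hb' hbb).1 ⟨hab.le, le_rfl⟩
  have hzc := (not_congr (hM z hzn z' hz'm hzz)).1 hz'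
  refine not_isCyclicallyEdgeConnected_of_cut G 5 S ?_ (u := x a) (v := y a') (u' := x 0)
    (v' := y 0) ((hSx a (by omega)).2 ⟨le_rfl, hab.le⟩) ((hSy a' ha'.le).2 hac) (M.adj_sub haa)
    (fun h' => by have := (hSx 0 (by omega)).1 h'; omega)
    (fun h' => by have := (hSy 0 (by omega)).1 h'; omega) (M.adj_sub h.base) ?_ ?_
  -- By `hM` no matching edge crosses, so only the edges at the ends of the two intervals can.
  · have hsub : {e | e ∈ G.edgeSet ∧ ∃ u ∈ S, ∃ v ∈ Sᶜ, e = s(u, v)} ⊆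
        (({s(x (a - 1), x a), s(x b, x (b + 1)), s(y (c - 1), y c), s(y d, y (d + 1))} :
          Finset (Sym2 V)) : Set (Sym2 V)) := by
      rintro e ⟨he, u, hu, v, hv, rfl⟩
      simp only [Finset.coe_insert, Finset.coe_singleton, Set.mem_insert_iff,
        Set.mem_singleton_iff]
      rcases h.edge _ _ he with h' | ⟨j, hj, h'⟩ | ⟨j, hj, h'⟩
      · exfalso
        rcases h.cover u with ⟨i, hi, rfl⟩ | ⟨i, hi, rfl⟩
        · obtain ⟨j, hj, hij⟩ := h.exists_right i hi
          obtain rfl := h.unique _ _ _ h' hij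
          exact hv ((hSy j hj.le).2 ((hM i hi j hj hij).1 ((hSx i hi.le).1 hu)))
        · obtain ⟨j, hj, hij⟩ := h.exists_left i hi
          obtain rfl := h.unique _ _ _ h' hij.symm
          exact hv ((hSx j hj.le).2 ((hM j hj i hi hij).2 ((hSy i hi.le).1 hu)))
      · have key : j + 1 = a ∨ j = b := by
          have h1 := hSx j hj.le
          have h2 := hSx (j + 1) hj
          rcases Sym2.eq_iff.1 h' with ⟨rfl, rfl⟩ | ⟨rfl, rfl⟩
          · have := h1.1 hu
            have := (not_congr h2).1 hv
            omega
          · have := h2.1 hu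
            have := (not_congr h1).1 hv
            omega
        rw [h']
        rcases key with rfl | rfl
        exacts [Or.inl rfl, Or.inr (Or.inl rfl)]
      · have key : j + 1 = c ∨ j = d := by
          have h1 := hSy j hj.le
          have h2 := hSy (j + 1) hj
          rcases Sym2.eq_iff.1 h' with ⟨rfl, rfl⟩ | ⟨rfl, rfl⟩
          · have := h1.1 hu
            have := (not_congr h2).1 hv
            omega
          · have := h2.1 hu
            have := (not_congr h1).1 hv
            omega
        rw [h']
        rcases key with rfl | rfl
        exacts [Or.inr (Or.inr (Or.inl rfl)), Or.inr (Or.inr (Or.inr rfl))]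
    refine (Set.encard_le_encard hsub).trans_lt ?_
    rw [Set.encard_coe_eq_coe_finsetCard]
    exact_mod_cast Finset.card_le_four.trans_lt (by norm_num)
  · intro K hK
    have h1 : K.Reachable (x a) (x b) := reachable_of_adj_succ x hab.le fun i hi hi' =>
      hK _ ((hSx i (by omega)).2 (by omega)) _ ((hSx _ (by omega)).2 (by omega))
        (h.left.adj i (by omega)) (hneM (by omega) (by omega) ha'.le)
    have h2 : K.Adj (x b) (y b') := by
      refine hK _ ((hSx b hb.le).2 (by omega)) _ ((hSy b' hb'.le).2 hbc) (M.adj_sub hbb) ?_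
      intro h'
      rcases Sym2.eq_iff.1 h' with ⟨h', -⟩ | ⟨h', -⟩
      · have := h.left.inj b hb a (by omega) h'
        omega
      · exact h.ne _ hb.le _ ha'.le h'
    have h3 : ∀ p q, p ≤ q → c ≤ p → q ≤ d → K.Reachable (y p) (y q) := fun p q hpq hp hq =>
      reachable_of_adj_succ y hpq fun i hi hi' =>
        hK _ ((hSy i (by omega)).2 (by omega)) _ ((hSy _ (by omega)).2 (by omega))
          (h.right.adj i (by omega)) (hneM' (by omega) (by omega) (by omega))
    refine (h1.trans h2.reachable).trans ?_
    rcases le_total b' a' with hle | hle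
    exacts [h3 _ _ hle hbc.1 hac.2, (h3 _ _ hle hac.1 hbc.2).symm]
  · intro K hK
    have h1 : K.Reachable (x 0) (x z) :=
      reachable_zero_of_adj_succ_outside h.left.closed (fun i hi hi1 hi2 =>
        hK _ ((not_congr (hSx i hi.le)).2 hi1) _ ((not_congr (hSx _ hi)).2 hi2)
          (h.left.adj i hi) (hneM hi.le hi (by omega))) hzn hz'
    have h2 : K.Reachable (y 0) (y z') :=
      reachable_zero_of_adj_succ_outside h.right.closed (fun i hi hi1 hi2 =>
        hK _ ((not_congr (hSy i hi.le)).2 hi1) _ ((not_congr (hSy _ hi)).2 hi2)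
          (h.right.adj i hi) (hneM' hi.le hi (by omega))) hz'm hzc
    have h3 : K.Adj (x z) (y z') := by
      refine hK _ ((not_congr (hSx z hzn.le)).2 hz') _ ((not_congr (hSy z' hz'm.le)).2 hzc)
        (M.adj_sub hzz) ?_
      intro h'
      rcases Sym2.eq_iff.1 h' with ⟨h', -⟩ | ⟨h', -⟩
      · have := h.left.inj z hzn 0 (by omega) h'
        omega
      · exact h.ne _ hzn.le _ (by omega) h'
    exact (h1.trans h3.reachable).trans h2.symm

theorem IsMarkedEnum.not_isCyclicallyEdgeConnected_of_split {V : Type*} {G : SimpleGraph V}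
    {M : G.Subgraph} {n m : ℕ} {x y : ℕ → V} (h : IsMarkedEnum M n m x y) (hn : 4 ≤ n) {k p : ℕ}
    (hk : 1 ≤ k) (hkn : k + 1 < n) (hp : 1 ≤ p) (hpm : p < m)
    (hM : (∀ i j, 0 < i → i < n → 0 < j → j < m → M.Adj (x i) (y j) → (i ≤ k ↔ j ≤ p)) ∨
      ∀ i j, 0 < i → i < n → 0 < j → j < m → M.Adj (x i) (y j) → (i ≤ k ↔ p ≤ j)) :
    ¬ IsCyclicallyEdgeConnected G 5 := by
  have hzero : ∀ i < n, ∀ j < m, M.Adj (x i) (y j) → (i = 0 ↔ j = 0) := by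
    intro i hi j hj hij
    constructor
    · rintro rfl
      exact h.right_eq hj (by omega) hij h.base
    · rintro rfl
      exact h.left_eq hi (by omega) hij h.base
  rcases hM with hM | hM
  · have key : ∀ i < n, ∀ j < m, M.Adj (x i) (y j) →
        (i = 0 ∧ j = 0 ∨ 0 < i ∧ 0 < j ∧ (i ≤ k ↔ j ≤ p)) := by
      intro i hi j hj hij
      have h0 := hzero i hi j hj hij
      by_cases hi0 : i = 0
      · exact Or.inl ⟨hi0, h0.1 hi0⟩
      · exact Or.inr ⟨by omega, by omega, hM i j (by omega) hi (by omega) hj hij⟩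
    -- A cycle inside needs two matching edges. If the initial block has only one, the complementary
    -- block `2, …, n - 1` is cut off instead, and the edges at `x 0` and `x 1` close the outer
    -- cycle.
    by_cases hk1 : k = 1
    · refine h.not_isCyclicallyEdgeConnected (a := 2) (b := n - 1) (c := p + 1) (d := m - 1)
        (z := 1) (by omega) (by omega) (by omega) (by omega) (by omega) (by omega) (by omega)
        (by omega) fun i hi j hj hij => ?_
      have := key i hi j hj hij
      omega
    · refine h.not_isCyclicallyEdgeConnected (a := 1) (b := k) (c := 1) (d := p)
        (z := k + 1) (by omega) (by omega) (by omega) (by omega) (by omega) (by omega) (by omega)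
        (by omega) fun i hi j hj hij => ?_
      have := key i hi j hj hij
      omega
  · have key : ∀ i < n, ∀ j < m, M.Adj (x i) (y j) →
        (i = 0 ∧ j = 0 ∨ 0 < i ∧ 0 < j ∧ (i ≤ k ↔ p ≤ j)) := by
      intro i hi j hj hij
      have h0 := hzero i hi j hj hij
      by_cases hi0 : i = 0
      · exact Or.inl ⟨hi0, h0.1 hi0⟩
      · exact Or.inr ⟨by omega, by omega, hM i j (by omega) hi (by omega) hj hij⟩
    by_cases hk1 : k = 1
    · refine h.not_isCyclicallyEdgeConnected (a := 2) (b := n - 1) (c := 1) (d := p - 1)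
        (z := 1) (by omega) (by omega) (by omega) (by omega) (by omega) (by omega) (by omega)
        (by omega) fun i hi j hj hij => ?_
      have := key i hi j hj hij
      omega
    · refine h.not_isCyclicallyEdgeConnected (a := 1) (b := k) (c := p) (d := m - 1)
        (z := k + 1) (by omega) (by omega) (by omega) (by omega) (by omega) (by omega) (by omega)
        (by omega) fun i hi j hj hij => ?_
      have := key i hi j hj hij
      omega

/-! ### The dichotomy applied to a marked permutation graph -/

/-- A proper initial segment of `{1, …, n - 1}` has the form `{1, …, k}`. -/
theorem exists_mem_iff_le_of_initial {n : ℕ} {A : Finset ℕ} (hA : A ⊆ Finset.Ico 1 n)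
    (hne : A.Nonempty) (hneq : A ≠ Finset.Ico 1 n)
    (h : ∀ a ∈ A, ∀ b ∈ Finset.Ico 1 n, b ∉ A → a < b) :
    ∃ k, 1 ≤ k ∧ k + 1 < n ∧ ∀ i, 0 < i → i < n → (i ∈ A ↔ i ≤ k) := by
  obtain ⟨k, hk, hmax⟩ := Finset.exists_max_image A id hne
  have hk' := Finset.mem_Ico.1 (hA hk)
  have key : ∀ i, 0 < i → i < n → (i ∈ A ↔ i ≤ k) := by
    intro i hi hin
    refine ⟨hmax i, fun hik => ?_⟩
    by_contra hiA
    have := h k hk i (Finset.mem_Ico.2 ⟨hi, hin⟩) hiA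
    omega
  refine ⟨k, hk'.1, ?_, key⟩
  by_contra hkn
  refine hneq (hA.antisymm fun i hi => ?_)
  rw [Finset.mem_Ico] at hi
  exact (key i hi.1 hi.2).2 (by omega)

theorem IsMarkedEnum.exists_isPetersenCopy_of_isCyclicallyEdgeConnected {V : Type*}
    {G : SimpleGraph V} {M : G.Subgraph} {n m : ℕ} {x y : ℕ → V} (h : IsMarkedEnum M n m x y)
    (hG : IsCyclicallyEdgeConnected G 5) :
    ∃ H : G.Subgraph, IsPetersenCopy M H ∧ s(x 0, y 0) ∈ H.edgeSet := by
  have hn := h.five_le hG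
  have h3 := h.three_le_right
  choose! f hf hadj using h.exists_right
  have hinj : Set.InjOn f (Finset.Ico 1 n : Finset ℕ) := by
    intro i hi j hj hij
    have hi := (Finset.mem_Ico.1 hi).2
    have hj := (Finset.mem_Ico.1 hj).2
    exact h.left_eq hi hj (hadj i hi) (hij ▸ hadj j hj)
  have hpos : ∀ i, 0 < i → i < n → 0 < f i := by
    intro i hi hin
    by_contra h0
    have h0 : f i = 0 := by omega
    have := h.left_eq hin (by omega) (hadj i hin) (h0 ▸ h.base)
    omega
  have hfeq : ∀ i j, i < n → j < m → M.Adj (x i) (y j) → j = f i := fun i j hi hj hij =>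
    h.right_eq hj (hf i hi) hij (hadj i hi)
  rcases hasSimplePattern_or_isDirectSplit f (Finset.Ico 1 n) hinj (by simp; omega) with
    hpat | ⟨A, hA, hne, hneq, hinit, hval⟩ | ⟨A, hA, hne, hneq, hinit, hval⟩
  · obtain ⟨a, ha, b, hb, c, hc, d, hd, hab, hbc, hcd, hpat⟩ := hpat
    rw [Finset.mem_Ico] at ha hb hc hd
    rcases hpat with ⟨h1, h2, h3⟩ | ⟨h1, h2, h3⟩
    · exact h.exists_isPetersenCopy ha.1 hab hbc hcd hd.2 (hpos b hb.1 hb.2) h1 h2 h3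
        (hf c hc.2) (hadj a ha.2) (hadj b hb.2) (hadj c hc.2) (hadj d hd.2)
    -- The pattern 2413 becomes 3142 after the second cycle is traversed backwards.
    · have ha' := hf a ha.2
      have hb' := hf b hb.2
      have hc' := hf c hc.2
      have hd' := hf d hd.2
      have hc0 := hpos c hc.1 hc.2
      have key : ∀ i, i < n → M.Adj (x i) (y (m - (m - f i))) := fun i hi => by
        rw [Nat.sub_sub_self (hf i hi).le]
        exact hadj i hi
      obtain ⟨H, hH, he⟩ := h.reverse_right.exists_isPetersenCopy ha.1 hab hbc hcd hd.2
        (a' := m - f a) (b' := m - f b) (c' := m - f c) (d' := m - f d)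
        (by omega) (by omega) (by omega) (by omega) (by omega)
        (key a ha.2) (key b hb.2) (key c hc.2) (key d hd.2)
      refine ⟨H, hH, ?_⟩
      rwa [Nat.sub_zero, h.right.closed] at he
  · obtain ⟨k, hk, hkn, hiff⟩ := exists_mem_iff_le_of_initial hA hne hneq hinit
    -- The largest value on the block is the threshold on the second cycle; for a skew sum below it
    -- is the smallest.
    obtain ⟨q, hq, hmax⟩ := Finset.exists_max_image A f hne
    have hq' := Finset.mem_Ico.1 (hA hq)
    refine (h.not_isCyclicallyEdgeConnected_of_split (by omega) hk hkn (hpos q hq'.1 hq'.2)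
      (hf q hq'.2) (Or.inl fun i j hi hin _ hjm hij => ?_) hG).elim
    rw [← hiff i hi hin, hfeq i j hin hjm hij]
    refine ⟨hmax i, fun hle => ?_⟩
    by_contra hiA
    exact (hval q hq i (Finset.mem_Ico.2 ⟨hi, hin⟩) hiA).not_ge hle
  · obtain ⟨k, hk, hkn, hiff⟩ := exists_mem_iff_le_of_initial hA hne hneq hinit
    obtain ⟨q, hq, hmin⟩ := Finset.exists_min_image A f hne
    have hq' := Finset.mem_Ico.1 (hA hq)
    refine (h.not_isCyclicallyEdgeConnected_of_split (by omega) hk hkn (hpos q hq'.1 hq'.2)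
      (hf q hq'.2) (Or.inr fun i j hi hin _ hjm hij => ?_) hG).elim
    rw [← hiff i hi hin, hfeq i j hin hjm hij]
    refine ⟨hmin i, fun hle => ?_⟩
    by_contra hiA
    exact (OrderDual.toDual_lt_toDual.1
      (hval q hq i (Finset.mem_Ico.2 ⟨hi, hin⟩) hiA)).not_ge hle

theorem exists_isMarkedEnum {V : Type*} {G : SimpleGraph V} {M C₁ C₂ : G.Subgraph}
    (hM : M.IsPerfectMatching) (hC₁ : IsCycleSubgraph C₁) (hC₂ : IsCycleSubgraph C₂)
    (hdisj : Disjoint C₁.verts C₂.verts)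
    (hdel : (⊤ : G.Subgraph).deleteEdges M.edgeSet = C₁ ⊔ C₂)
    (hi₁ : C₁.IsInduced) (hi₂ : C₂.IsInduced) {u w : V} (huw : M.Adj u w) (hu : u ∈ C₁.verts) :
    ∃ (n m : ℕ) (x y : ℕ → V), IsMarkedEnum M n m x y ∧ x 0 = u ∧ y 0 = w := by
  have hM' := SimpleGraph.Subgraph.isPerfectMatching_iff.1 hM
  have hcover : ∀ v, v ∈ C₁.verts ∨ v ∈ C₂.verts := by
    intro v
    have : v ∈ ((⊤ : G.Subgraph).deleteEdges M.edgeSet).verts := Set.mem_univ v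
    rwa [hdel] at this
  have hadj : ∀ a b, G.Adj a b ∧ ¬ M.Adj a b ↔ C₁.Adj a b ∨ C₂.Adj a b := by
    intro a b
    rw [← SimpleGraph.Subgraph.sup_adj, ← hdel, SimpleGraph.Subgraph.deleteEdges_adj]
    simp
  -- A matching edge with both ends on an induced cycle would be an edge of that cycle, hence not in
  -- `M`.
  have h12 : ∀ a b, M.Adj a b → a ∈ C₁.verts → b ∈ C₂.verts := fun a b hab ha =>
    (hcover b).resolve_left fun hb =>
      ((hadj a b).2 (Or.inl (hi₁ ha hb (M.adj_sub hab)))).2 hab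
  have h21 : ∀ a b, M.Adj a b → a ∈ C₂.verts → b ∈ C₁.verts := fun a b hab ha =>
    (hcover b).resolve_right fun hb =>
      ((hadj a b).2 (Or.inr (hi₂ ha hb (M.adj_sub hab)))).2 hab
  obtain ⟨n, x, hn, rfl, hx, hxv, hxe⟩ := hC₁.exists_isCyclicEnum hu
  obtain ⟨m, y, hm, rfl, hy, hyv, hye⟩ := hC₂.exists_isCyclicEnum (h12 _ _ huw hu)
  refine ⟨n, m, x, y, ⟨hx, hy, hn, hm, ?_, ?_, ?_, ?_, ?_, ?_, ?_, ?_, huw⟩, rfl, rfl⟩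
  · intro i hi j hj hij
    exact Set.disjoint_left.1 hdisj ((hxv _).2 (hx.exists_lt_eq (by omega) hi))
      (hij ▸ (hyv _).2 (hy.exists_lt_eq (by omega) hj))
  · intro v
    rw [← hxv, ← hyv]
    exact hcover v
  · intro a b hab
    rw [← hxe, ← hye, ← hadj]
    tauto
  · intro i hi
    exact ((hadj _ _).2 (Or.inl ((hxe _ _).2 ⟨i, hi, rfl⟩))).2
  · intro j hj
    exact ((hadj _ _).2 (Or.inr ((hye _ _).2 ⟨j, hj, rfl⟩))).2
  · intro i hi
    obtain ⟨b, hb, -⟩ := hM' (x i)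
    obtain ⟨j, hj, rfl⟩ := (hyv b).1 (h12 _ _ hb ((hxv _).2 ⟨i, hi, rfl⟩))
    exact ⟨j, hj, hb⟩
  · intro j hj
    obtain ⟨b, hb, -⟩ := hM' (y j)
    obtain ⟨i, hi, rfl⟩ := (hxv b).1 (h21 _ _ hb ((hyv _).2 ⟨j, hj, rfl⟩))
    exact ⟨i, hi, hb.symm⟩
  · intro a b c hab hac
    exact (hM' a).unique hab hac

theorem corollary3 {V : Type*} [Fintype V] (G : SimpleGraph V) [DecidableRel G.Adj]
    (M : G.Subgraph) (hGM : IsMarkedPermutationGraph G M)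
    (hconn : IsCyclicallyEdgeConnected G 5) :
    ∀ e ∈ G.edgeSet, ∃ H : G.Subgraph, IsPetersenCopy M H ∧ e ∈ H.edgeSet := by
  obtain ⟨-, hM, C₁, C₂, hC₁, hC₂, hdisj, hdel, hi₁, hi₂⟩ := hGM
  have key : ∀ u w, M.Adj u w → ∃ H : G.Subgraph, IsPetersenCopy M H ∧ s(u, w) ∈ H.edgeSet := by
    intro u w huw
    have hu : u ∈ ((⊤ : G.Subgraph).deleteEdges M.edgeSet).verts := Set.mem_univ u
    rw [hdel] at hu
    rcases hu with hu | hu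
    · obtain ⟨n, m, x, y, h, rfl, rfl⟩ :=
        exists_isMarkedEnum hM hC₁ hC₂ hdisj hdel hi₁ hi₂ huw hu
      exact h.exists_isPetersenCopy_of_isCyclicallyEdgeConnected hconn
    · obtain ⟨n, m, x, y, h, rfl, rfl⟩ :=
        exists_isMarkedEnum hM hC₂ hC₁ hdisj.symm (hdel.trans (sup_comm _ _)) hi₂ hi₁ huw hu
      exact h.exists_isPetersenCopy_of_isCyclicallyEdgeConnected hconn
  intro e he
  induction e using Sym2.ind with
  | _ u v =>
    by_cases huv : M.Adj u v
    · exact key u v huv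
    -- Any `M`-copy contains all edges outside `M`; the matching edge at `u` merely supplies one.
    · obtain ⟨w, huw, -⟩ := SimpleGraph.Subgraph.isPerfectMatching_iff.1 hM u
      obtain ⟨H, hH, -⟩ := key u w huw
      refine ⟨H, hH, ?_⟩
      obtain ⟨-, S, -, -, -, hedge⟩ := hH
      rw [hedge]
      exact Or.inl ⟨he, huv⟩
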